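/- Let $d\ge 2$ and $c_d:=\left(\frac{d-2}{2}\right)^2$. Let $B=(B_{jk})$ be a smooth closed $2$-form on $\mathbb{R}^d$ (the magnetic field). Let $A^B$ be its vector potential in the Poincaré gauge, $$A^B_j(x)=\int_0^1 \sum_{l=1}^d x^l B_{lj}(ux)\,u\,\mathrm{d}u ,\qquad j=1,\dots,d,$$ and for $r>0$ and $\sigma\in S^{d-1}$ let $\mathsf{A}(\sigma,r)$ be the $1$-form $v\mapsto r\,A^B(r\sigma)\cdot v$ on the tangent space $T_\sigma S^{d-1}$. Define the spherical eigenvalue function $$\nu_B(r):=\inf_{\substack{\varphi\in H^1(S^{d-1};\mathbb{C})\\ \varphi\neq0}}\frac{\int_{S^{d-1}}\big|(\mathrm{d}'-i\mathsf{A}(\sigma,r))\varphi(\sigma)\big|^2_{S^{d-1}}\,\mathrm{d}\sigma}{\int_{S^{d-1}}|\varphi(\sigma)|^2\,\mathrm{d}\sigma},\qquad r>0,$$ where $\mathrm{d}'$ is the exterior derivative on the unit sphere $S^{d-1}$, $|\cdot|_{S^{d-1}}$ is the norm of covectors on $S^{d-1}$ and $\mathrm{d}\sigma$ is the surface measure.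 Theorem. If $\nu_B$ is not identically zero on $(0,\infty)$, then there exists a constant $c_{d,B}>0$ such that for every smooth $1$-form $A$ on $\mathbb{R}^d$ with $\mathrm{d}A=B$ and every $\psi\in C_0^\infty(\mathbb{R}^d;\mathbb{C})$, $$\int_{\mathbb{R}^d}|(\nabla-iA)\psi(x)|^2\,\mathrm{d}x-c_d\int_{\mathbb{R}^d}\frac{|\psi(x)|^2}{|x|^2}\,\mathrm{d}x\ \ge\ c_{d,B}\int_{\mathbb{R}^d}\frac{|\psi(x)|^2}{1+|x|^2\log^2|x|}\,\mathrm{d}x ,$$ where for $d=2$ (so $c_2=0$) the second term on the left is absent. -/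

import Mathlib

open MeasureTheory Filter Topology
open scoped ContDiff ENNReal

noncomputable section

namespace MagneticHardy

/-- The Euclidean space `ℝ^d`. -/
abbrev E (d : ℕ) : Type := EuclideanSpace ℝ (Fin d)

/-- Differential `k`-forms on `ℝ^d`, not necessarily smooth. The exterior derivative is Mathlib's
`extDeriv`; for a `1`-form `A` it satisfies `(dA)(e_j, e_k) = ∂_j A_k - ∂_k A_j`. -/
abbrev Form (d k : ℕ) : Type := E d → (E d) [⋀^Fin k]→L[ℝ] ℝ

/-- The `j`-th vector of the Cartesian coordinate basis of `ℝ^d`. -/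
def stdVec {d : ℕ} (j : Fin d) : E d := EuclideanSpace.single j 1

/-- The best constant `c_d = ((d - 2) / 2)^2` in the classical Hardy inequality (`d ≥ 2`). -/
def hardyConst (d : ℕ) : ℝ := (((d : ℝ) - 2) / 2) ^ 2

/-- The magnetic gradient `(∇ - iA)ψ`, with components `∂_j ψ - i A_j ψ`. -/
def magGrad {d : ℕ} (A : Form d 1) (ψ : E d → ℂ) (x : E d) : EuclideanSpace ℂ (Fin d) :=
  WithLp.toLp 2 fun j =>
    fderiv ℝ ψ x (stdVec j) - Complex.I * ((A x ![stdVec j] : ℝ) : ℂ) * ψ x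

/-- The quadratic form `h_B[ψ] = ∫ |(∇ - iA)ψ|² dx - c_d ∫ |ψ|² / |x|² dx`. -/
def magForm {d : ℕ} (A : Form d 1) (ψ : E d → ℂ) : ℝ :=
  (∫ x, ‖magGrad A ψ x‖ ^ 2) - hardyConst d * ∫ x, ‖ψ x‖ ^ 2 / ‖x‖ ^ 2

/-- The potential of `B` in the Poincaré gauge,
`A_j(x) = ∫₀¹ x^l B_{lj}(ux) u du = ∫₀¹ B(ux)(x, e_j) u du`. -/
def poincarePotential {d : ℕ} (B : Form d 2) (x : E d) : E d :=
  WithLp.toLp 2 fun j => ∫ u in (0 : ℝ)..1, B (u • x) ![x, stdVec j] * u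

/-- The unit sphere `S^{d-1}`. -/
abbrev Sph (d : ℕ) : Type := Metric.sphere (0 : E d) 1

/-- The surface measure of `S^{d-1}`. -/
def surf (d : ℕ) : Measure (Sph d) := (volume : Measure (E d)).toSphere

/-- The angular part, at the point `rσ`, of the Poincaré potential in spherical coordinates: the
`1`-form `v ↦ A(rσ)(r v)` on `T_σ S^{d-1}`. Covectors on `T_σ S^{d-1}` are represented by vectors of
`ℝ^d` (or of `ℂ^d`) orthogonal to `σ`, so that `|·|_{S^{d-1}}` becomes the Euclidean norm;
`A(rσ)` is orthogonal to `σ` by antisymmetry of `B`. -/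
def sphPotential {d : ℕ} (B : Form d 2) (r : ℝ) (σ : Sph d) : E d :=
  r • poincarePotential B (r • (σ : E d))

/-- The exterior derivative `d'φ` on `S^{d-1}` of the restriction `φ` to the sphere of a smooth
function `Φ` on `ℝ^d`, represented by the tangential gradient: its `j`-th component is the derivative
of `Φ` at `σ` along the orthogonal projection `e_j - σ_j σ` of `e_j` to `T_σ S^{d-1}`. -/
def sphGrad {d : ℕ} (Φ : E d → ℂ) (σ : Sph d) : EuclideanSpace ℂ (Fin d) :=
  WithLp.toLp 2 fun j =>
    fderiv ℝ Φ (σ : E d) (stdVec j - ((σ : E d) j) • (σ : E d))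

/-- `φ ∈ H¹(S^{d-1})` with differential `d'φ = G`. The space `H¹(S^{d-1})` is the closure of
`C^∞(S^{d-1})` in the norm `(‖φ‖² + ‖d'φ‖²)^{1/2}`, the smooth functions on the sphere being the
restrictions of smooth functions on `ℝ^d`. -/
def IsH1 {d : ℕ} (φ : Sph d → ℂ) (G : Sph d → EuclideanSpace ℂ (Fin d)) : Prop :=
  MemLp φ 2 (surf d) ∧ MemLp G 2 (surf d) ∧
    ∃ Φ : ℕ → E d → ℂ, (∀ n, ContDiff ℝ ∞ (Φ n)) ∧
      Tendsto (fun n => eLpNorm (fun σ : Sph d => Φ n σ - φ σ) 2 (surf d)) atTop (𝓝 0) ∧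
      Tendsto (fun n => eLpNorm (fun σ : Sph d => sphGrad (Φ n) σ - G σ) 2 (surf d)) atTop (𝓝 0)

/-- `(d' - i a)φ` for a real covector `a` and a complex number `φ`, where `G` stands for `d'φ`. -/
def magCovec {d : ℕ} (a : E d) (φ : ℂ) (G : EuclideanSpace ℂ (Fin d)) :
    EuclideanSpace ℂ (Fin d) :=
  WithLp.toLp 2 fun j => G j - Complex.I * ((a j : ℝ) : ℂ) * φ

/-- The spherical eigenvalue function `ν_B(r)`: the infimum over the non-zero `φ ∈ H¹(S^{d-1})` of
`∫ |(d' - i𝖠(σ,r))φ|² dσ / ∫ |φ|² dσ`. -/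
def nu {d : ℕ} (B : Form d 2) (r : ℝ) : ℝ :=
  sInf {q : ℝ | ∃ (φ : Sph d → ℂ) (G : Sph d → EuclideanSpace ℂ (Fin d)),
    IsH1 φ G ∧ ¬ (φ =ᵐ[surf d] 0) ∧
      q = (∫ σ, ‖magCovec (sphPotential B r σ) (φ σ) (G σ)‖ ^ 2 ∂(surf d)) /
        ∫ σ, ‖φ σ‖ ^ 2 ∂(surf d)}

end MagneticHardy

end

/-!
In the Poincaré gauge the potential has no radial component. Every `A` with `dA = B` is brought into
that gauge by the function `χ(x) = ∫₀¹ A(ux)(x) du` (`poincarePotential_apply`), and the magnetic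
gradient is gauge covariant (`norm_magGrad_eq`), so it suffices to treat the potential
`poincarePotential B`. In polar coordinates the energy then splits into the radial part
`∫∫ |∂_r ψ|² r^{d-1} dr dσ` and a tangential part, which at each radius is the spherical energy from
the definition of `ν_B` (`norm_sq_magCovec_polar`).

On every ray the radial part, with the Hardy term subtracted, is bounded below by the logarithmic
weight, except for a term `δ t^{d-2} |ψ(tσ)|²` at a single radius `t` (`exists_radial_hardy`). This
is integration by parts against the supersolution `r^{-(d-2)/2} |c - log r|^{δ/2}`, with one value
of `c` on each side of `t`; the jump between the two gives the point term. The number `δ > 0` may be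
chosen as small as desired, at the expense of the constant in front of the weight.

The tangential part pays for the point term. Since `ν_B(r₀) > 0` for some `r₀`, continuity of the
potential gives a uniform gap `κ` on the spheres of radius `r ∈ [r₁, r₂]`
(`exists_uniform_gap`). If the radial part, with the Hardy term and the weight subtracted,
integrates to `I < 0`, then `t^{d-2} ∫ |ψ(tσ)|² dσ ≥ -I/δ` for all `t ∈ [r₁, r₂]`, so the gap
bounds the tangential part from below by a multiple of `-I/δ`, which is at least `-I` when `δ` is
small (`exists_hardy_poincare_gauge`).
-/

noncomputable section

namespace MagneticHardy

/-! ### The radial Hardy inequality -/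

/-- The integrand `r^{n+1} (|f'|² - (n/2)² |f|²/r² - γ |f|²/(1 + r² log² r))` of the radial Hardy
inequality in dimension `n + 2`, including the Jacobian `r^{n+1}` of polar coordinates. -/
def radialDensity (n : ℕ) (γ : ℝ) (f : ℝ → ℂ) (r : ℝ) : ℝ :=
  r ^ (n + 1) * (‖deriv f r‖ ^ 2 - ((n : ℝ) / 2) ^ 2 * (‖f r‖ ^ 2 / r ^ 2)
    - γ * (‖f r‖ ^ 2 / (1 + r ^ 2 * Real.log r ^ 2)))

/-- The logarithmic derivative (times `-r`) of the supersolution `r^{-n/2} |c - log r|^{δ/2}` used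
in the radial Hardy inequality. -/
def hardySlope (n : ℕ) (δ c r : ℝ) : ℝ := (n : ℝ) / 2 + δ / (2 * (c - Real.log r))

lemma hasDerivAt_hardySlope (n : ℕ) (δ c : ℝ) {r : ℝ} (hr : 0 < r) (hc : c - Real.log r ≠ 0) :
    HasDerivAt (hardySlope n δ c) (δ / (2 * (c - Real.log r) ^ 2) / r) r := by
  unfold hardySlope
  have h1 : HasDerivAt (fun r => 2 * (c - Real.log r)) (2 * (-r⁻¹)) r :=
    ((Real.hasDerivAt_log hr.ne').const_sub c).const_mul 2
  have h2 := ((hasDerivAt_const r δ).div h1 (by simpa using hc)).const_add ((n : ℝ) / 2)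
  refine h2.congr_deriv ?_
  field_simp
  ring

lemma continuousOn_radialDensity (n : ℕ) (γ : ℝ) {f : ℝ → ℂ} (hf : ContDiff ℝ 1 f) :
    ContinuousOn (radialDensity n γ f) (Set.Ioi 0) := by
  have hf' : Continuous (deriv f) := hf.continuous_deriv le_rfl
  have hf0 : Continuous f := hf.continuous
  have hl : ContinuousOn Real.log (Set.Ioi (0 : ℝ)) :=
    Real.continuousOn_log.mono fun x hx => (ne_of_gt hx : x ≠ 0)
  unfold radialDensity
  refine ContinuousOn.mul (by fun_prop) (ContinuousOn.sub (ContinuousOn.sub (by fun_prop)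
    (continuousOn_const.mul (ContinuousOn.div (by fun_prop) (by fun_prop) ?_)))
    (continuousOn_const.mul (ContinuousOn.div (by fun_prop) (by fun_prop) ?_)))
  · intro x hx
    have : (0 : ℝ) < x := hx
    positivity
  · intro x _
    positivity

/-- Completing the square in `|f' + (q/r) f|² ≥ 0`, where `q` is `hardySlope`, bounds the radial
density from below by an exact derivative. -/
lemma neg_deriv_le_radialDensity (n : ℕ) {δ c γ r : ℝ} (hδ0 : 0 ≤ δ) (hδ1 : δ ≤ 1) (hr : 0 < r)
    (hc : c - Real.log r ≠ 0)
    (hγ : 4 * γ * (r ^ 2 * (c - Real.log r) ^ 2) ≤ δ * (1 + r ^ 2 * Real.log r ^ 2))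
    (f : ℝ → ℂ) :
    -((δ / (2 * (c - Real.log r) ^ 2) / r) * (r ^ n * ‖f r‖ ^ 2) +
      hardySlope n δ c r * ((n * r ^ (n - 1)) * ‖f r‖ ^ 2 +
        r ^ n * (2 * inner ℝ (f r) (deriv f r)))) ≤ radialDensity n γ f r := by
  set q := hardySlope n δ c r with hq
  set L := Real.log r
  have hsq : 0 ≤ ‖deriv f r‖ ^ 2 + 2 * (q / r) * inner ℝ (f r) (deriv f r)
      + (q / r) ^ 2 * ‖f r‖ ^ 2 := by
    have := norm_add_sq_real (deriv f r) ((q / r) • f r)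
    rw [inner_smul_right, norm_smul, real_inner_comm, mul_pow, Real.norm_eq_abs, sq_abs] at this
    have h0 := sq_nonneg ‖deriv f r + (q / r) • f r‖
    linarith
  have hn : (n : ℝ) * r ^ (n - 1) = n * r ^ n / r := by
    rcases n with _ | n
    · simp
    · simp [pow_succ]
      field_simp
  have hpot : γ * (r ^ 2 / (1 + r ^ 2 * L ^ 2)) ≤ δ / (4 * (c - L) ^ 2) := by
    have h2 : 0 < (c - L) ^ 2 := by positivity
    have h1 : 0 < 1 + r ^ 2 * L ^ 2 := by positivity
    rw [← mul_div_assoc, div_le_div_iff₀ h1 (by positivity)]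
    linarith
  have hqq : q = (n : ℝ) / 2 + δ / (2 * (c - L)) := hq
  have hric : γ * (r ^ 2 / (1 + r ^ 2 * L ^ 2)) ≤
      δ / (2 * (c - L) ^ 2) + q * n - q ^ 2 - ((n : ℝ) / 2) ^ 2 := by
    have : δ / (2 * (c - L) ^ 2) + q * n - q ^ 2 - ((n : ℝ) / 2) ^ 2
        = δ / (4 * (c - L) ^ 2) + δ * (1 - δ) / (4 * (c - L) ^ 2) := by
      rw [hqq]
      field_simp
      ring
    have h3 : 0 ≤ δ * (1 - δ) / (4 * (c - L) ^ 2) :=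
      div_nonneg (mul_nonneg hδ0 (by linarith)) (by positivity)
    linarith
  have hF : 0 ≤ r ^ n * (‖f r‖ ^ 2 / r) := by positivity
  have hkey := mul_le_mul_of_nonneg_right hric hF
  have hsq' := mul_nonneg (by positivity : 0 ≤ r ^ n * r) hsq
  have h1 : 0 < 1 + r ^ 2 * L ^ 2 := by positivity
  rw [hn]
  unfold radialDensity
  rw [← sub_nonneg]
  have e : r ^ (n + 1) * (‖deriv f r‖ ^ 2 - ((n : ℝ) / 2) ^ 2 * (‖f r‖ ^ 2 / r ^ 2)
      - γ * (‖f r‖ ^ 2 / (1 + r ^ 2 * L ^ 2))) -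
      -((δ / (2 * (c - L) ^ 2) / r) * (r ^ n * ‖f r‖ ^ 2) +
      q * ((n * r ^ n / r) * ‖f r‖ ^ 2 + r ^ n * (2 * inner ℝ (f r) (deriv f r)))) =
      r ^ n * r * (‖deriv f r‖ ^ 2 + 2 * (q / r) * inner ℝ (f r) (deriv f r)
      + (q / r) ^ 2 * ‖f r‖ ^ 2) +
      ((δ / (2 * (c - L) ^ 2) + q * n - q ^ 2 - ((n : ℝ) / 2) ^ 2) * (r ^ n * (‖f r‖ ^ 2 / r)) -
      γ * (r ^ 2 / (1 + r ^ 2 * L ^ 2)) * (r ^ n * (‖f r‖ ^ 2 / r))) := by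
    generalize δ / (2 * (c - L) ^ 2) = X
    generalize inner ℝ (f r) (deriv f r) = I
    field_simp
    ring
  rw [e]
  linarith

/-- The radial Hardy inequality on a segment, with its boundary terms. -/
lemma boundary_le_integral_radialDensity (n : ℕ) {δ c γ x y : ℝ} (hδ0 : 0 ≤ δ) (hδ1 : δ ≤ 1)
    (hx : 0 < x) (hxy : x ≤ y) (hc : ∀ r ∈ Set.Icc x y, c - Real.log r ≠ 0)
    (hγ : ∀ r ∈ Set.Icc x y,
      4 * γ * (r ^ 2 * (c - Real.log r) ^ 2) ≤ δ * (1 + r ^ 2 * Real.log r ^ 2))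
    {f : ℝ → ℂ} (hf : ContDiff ℝ 1 f) :
    hardySlope n δ c x * (x ^ n * ‖f x‖ ^ 2) - hardySlope n δ c y * (y ^ n * ‖f y‖ ^ 2) ≤
      ∫ r in x..y, radialDensity n γ f r := by
  have hpos : ∀ r ∈ Set.Icc x y, 0 < r := fun r hr => hx.trans_le hr.1
  have hd : ∀ r ∈ Set.Icc x y,
      HasDerivAt (fun r => -(hardySlope n δ c r * (r ^ n * ‖f r‖ ^ 2)))
      (-((δ / (2 * (c - Real.log r) ^ 2) / r) * (r ^ n * ‖f r‖ ^ 2) +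
      hardySlope n δ c r * ((n * r ^ (n - 1)) * ‖f r‖ ^ 2 +
        r ^ n * (2 * inner ℝ (f r) (deriv f r))))) r := by
    intro r hr
    have hfd : HasDerivAt f (deriv f r) r :=
      (hf.differentiable one_ne_zero).differentiableAt.hasDerivAt
    exact ((hasDerivAt_hardySlope n δ c (hpos r hr) (hc r hr)).mul
      ((hasDerivAt_pow n r).mul hfd.norm_sq)).neg
  have := intervalIntegral.sub_le_integral_of_hasDeriv_right_of_le hxy
    (fun r hr => (hd r hr).continuousAt.continuousWithinAt)
    (fun r hr => (hd r (Set.Ioo_subset_Icc_self hr)).hasDerivWithinAt)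
    (((continuousOn_radialDensity n γ hf).mono fun r hr => hpos r hr).integrableOn_Icc)
    (fun r hr => by
      have hr' := Set.Ioo_subset_Icc_self hr
      exact neg_deriv_le_radialDensity n hδ0 hδ1 (hpos r hr') (hc r hr') (hγ r hr') f)
  linarith

/-- The weight `1/(r² (c - log r)²)` produced by the supersolution dominates the weight
`1/(1 + r² log² r)`, up to a constant. -/
lemma sq_mul_sub_log_sq_le (c : ℝ) {r : ℝ} (hr : 0 < r) :
    r ^ 2 * (c - Real.log r) ^ 2 ≤ (8 * c ^ 2 + 2) * (1 + r ^ 2 * Real.log r ^ 2) := by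
  set L := Real.log r
  have h1 : r ^ 2 ≤ 4 * (1 + r ^ 2 * L ^ 2) := by
    rcases le_total (1 / 2) L with h | h
    · have : 1 / 4 ≤ L ^ 2 := by nlinarith
      nlinarith [sq_nonneg r]
    · have h2 : r ≤ Real.exp (1 / 2) := by
        rw [← Real.exp_log hr]
        exact Real.exp_le_exp.2 h
      have h3 : r ^ 2 ≤ Real.exp 1 := by
        calc r ^ 2 ≤ Real.exp (1 / 2) ^ 2 := by gcongr
          _ = Real.exp 1 := by rw [← Real.exp_nat_mul]; norm_num
      have := Real.exp_one_lt_d9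
      nlinarith [sq_nonneg (r * L)]
  have h2 : (c - L) ^ 2 ≤ 2 * c ^ 2 + 2 * L ^ 2 := by nlinarith [sq_nonneg (c + L)]
  calc r ^ 2 * (c - L) ^ 2 ≤ r ^ 2 * (2 * c ^ 2 + 2 * L ^ 2) := by gcongr
    _ = 2 * c ^ 2 * r ^ 2 + 2 * (r ^ 2 * L ^ 2) := by ring
    _ ≤ 2 * c ^ 2 * (4 * (1 + r ^ 2 * L ^ 2)) + 2 * (1 + r ^ 2 * L ^ 2) := by
        gcongr; linarith
    _ = _ := by ring

/-- The radial Hardy inequality with a logarithmic remainder holds on the whole half-line up to a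
point evaluation at any `t ∈ [r₁, r₂]`, with constants depending only on `δ`, `r₁`, `r₂`. -/
theorem exists_radial_hardy {δ r₁ r₂ : ℝ} (hδ0 : 0 < δ) (hδ1 : δ ≤ 1) (h₁ : 0 < r₁) :
    ∃ γ : ℝ, 0 < γ ∧ ∀ (n : ℕ) (f : ℝ → ℂ), ContDiff ℝ 1 f → HasCompactSupport f →
      IntegrableOn (radialDensity n γ f) (Set.Ioi 0) → ∀ t ∈ Set.Icc r₁ r₂,
        0 ≤ (∫ r in Set.Ioi 0, radialDensity n γ f r) + δ * (t ^ n * ‖f t‖ ^ 2) := by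
  -- the singularities `log r = b`, `log r = a` of the two slopes lie at distance at least `1` from
  -- the logarithms of the radii where the respective slope is used
  set b := Real.log r₂ + 1 with hb
  set a := Real.log r₁ - 1 with ha
  set K := (8 * a ^ 2 + 2) + (8 * b ^ 2 + 2) with hK
  have hKpos : 0 < K := by positivity
  refine ⟨δ / (4 * K), by positivity, fun n f hf hsupp hint t ht => ?_⟩
  have ht0 : 0 < t := h₁.trans_le ht.1
  have hγ : ∀ c : ℝ, 8 * c ^ 2 + 2 ≤ K → ∀ r : ℝ, 0 < r →
      4 * (δ / (4 * K)) * (r ^ 2 * (c - Real.log r) ^ 2) ≤ δ * (1 + r ^ 2 * Real.log r ^ 2) := by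
    intro c hc r hr
    have h := sq_mul_sub_log_sq_le c hr
    have h1 : (0 : ℝ) < 1 + r ^ 2 * Real.log r ^ 2 := by positivity
    have h' : r ^ 2 * (c - Real.log r) ^ 2 ≤ K * (1 + r ^ 2 * Real.log r ^ 2) :=
      h.trans (by gcongr)
    calc 4 * (δ / (4 * K)) * (r ^ 2 * (c - Real.log r) ^ 2)
        ≤ 4 * (δ / (4 * K)) * (K * (1 + r ^ 2 * Real.log r ^ 2)) := by gcongr
      _ = _ := by field_simp
  -- a point `T` beyond `t` after which `f` vanishes
  obtain ⟨T, hT⟩ : ∃ T, t ≤ T ∧ ∀ r, T ≤ r → f r = 0 := by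
    obtain ⟨R, hR⟩ := hsupp.isCompact.isBounded.subset_closedBall 0
    refine ⟨max t (R + 1), le_max_left _ _, fun r hr => ?_⟩
    by_contra hne
    have := hR (subset_tsupport f hne)
    rw [Metric.mem_closedBall, dist_zero_right, Real.norm_eq_abs] at this
    have := le_abs_self r
    have := le_max_right t (R + 1)
    linarith
  obtain ⟨htT, hT⟩ := hT
  have hzero : ∀ r, T < r → radialDensity n (δ / (4 * K)) f r = 0 := by
    intro r hr
    have h0 : f r = 0 := hT r hr.le
    have h1 : deriv f r = 0 := by
      have : f =ᶠ[𝓝 r] fun _ => 0 := by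
        filter_upwards [lt_mem_nhds hr] with s hs using hT s hs.le
      rw [this.deriv_eq]; simp
    simp [radialDensity, h0, h1]
  have hright := boundary_le_integral_radialDensity n (c := a) (γ := δ / (4 * K)) hδ0.le hδ1 ht0 htT
    (fun r hr => by
      have : Real.log r₁ ≤ Real.log r := Real.log_le_log h₁ (ht.1.trans hr.1)
      rw [ha]; intro h; linarith)
    (fun r hr => hγ a (by rw [hK]; nlinarith [sq_nonneg b]) r (ht0.trans_le hr.1)) hf
  have hleft : ∀ ε, 0 < ε → ε ≤ t → -(hardySlope n δ b t * (t ^ n * ‖f t‖ ^ 2)) ≤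
      ∫ r in ε..t, radialDensity n (δ / (4 * K)) f r := by
    intro ε hε hεt
    have hlog : ∀ r ∈ Set.Icc ε t, 1 ≤ b - Real.log r := fun r hr => by
      have : Real.log r ≤ Real.log r₂ := Real.log_le_log (hε.trans_le hr.1) (hr.2.trans ht.2)
      rw [hb]; linarith
    have h := boundary_le_integral_radialDensity n (c := b) (γ := δ / (4 * K)) hδ0.le hδ1 hε hεt
      (fun r hr => by have := hlog r hr; intro h; linarith)
      (fun r hr => hγ b (by rw [hK]; nlinarith [sq_nonneg a]) r (hε.trans_le hr.1)) hf
    -- the boundary term at `ε` has a favourable sign, because `hardySlope` is positive there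
    have hq : 0 ≤ hardySlope n δ b ε := by
      have := hlog ε ⟨le_rfl, hεt⟩
      unfold hardySlope
      have : 0 ≤ δ / (2 * (b - Real.log ε)) := div_nonneg hδ0.le (by linarith)
      positivity
    have : 0 ≤ hardySlope n δ b ε * (ε ^ n * ‖f ε‖ ^ 2) := by positivity
    linarith
  have hint' : ∀ x y : ℝ, 0 ≤ x → 0 ≤ y →
      IntervalIntegrable (radialDensity n (δ / (4 * K)) f) volume x y := by
    intro x y hx hy
    rw [intervalIntegrable_iff]
    exact hint.mono_set fun r hr => (le_min hx hy).trans_lt hr.1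
  have hleft0 : -(hardySlope n δ b t * (t ^ n * ‖f t‖ ^ 2)) ≤
      ∫ r in (0 : ℝ)..t, radialDensity n (δ / (4 * K)) f r := by
    have hcont : ContinuousWithinAt
        (fun ε => ∫ r in ε..t, radialDensity n (δ / (4 * K)) f r) (Set.Ioc 0 t) 0 := by
      have h := intervalIntegral.continuousOn_primitive_interval' (hint' 0 t le_rfl ht0.le)
        (Set.left_mem_uIcc (a := 0) (b := t))
      have h2 : ContinuousWithinAt (fun ε => (∫ r in (0 : ℝ)..t, radialDensity n (δ / (4 * K)) f r)
          - ∫ r in (0 : ℝ)..ε, radialDensity n (δ / (4 * K)) f r) (Set.Ioc 0 t) 0 := by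
        refine continuousWithinAt_const.sub ((h 0 Set.left_mem_uIcc).mono ?_)
        rw [Set.uIcc_of_le ht0.le]
        exact Set.Ioc_subset_Icc_self
      refine h2.congr (fun ε hε => ?_) (by simp)
      rw [intervalIntegral.integral_interval_sub_left (hint' 0 t le_rfl ht0.le)
        (hint' 0 ε le_rfl hε.1.le)]
    have : (𝓝[Set.Ioc 0 t] (0 : ℝ)).NeBot := by
      rw [nhdsWithin_Ioc_eq_nhdsGT ht0]; infer_instance
    exact ge_of_tendsto hcont (eventually_nhdsWithin_of_forall fun ε hε => hleft ε hε.1 hε.2)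
  have hsplit : ∫ r in Set.Ioi 0, radialDensity n (δ / (4 * K)) f r =
      (∫ r in (0 : ℝ)..t, radialDensity n (δ / (4 * K)) f r) +
      ∫ r in t..T, radialDensity n (δ / (4 * K)) f r := by
    rw [intervalIntegral.integral_add_adjacent_intervals (hint' 0 t le_rfl ht0.le)
      (hint' t T ht0.le (ht0.le.trans htT)), intervalIntegral.integral_of_le (ht0.le.trans htT)]
    refine (setIntegral_eq_of_subset_of_forall_sdiff_eq_zero measurableSet_Ioi
      Set.Ioc_subset_Ioi_self fun r hr => hzero r ?_)
    by_contra h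
    exact hr.2 ⟨hr.1, not_lt.1 h⟩
  have hqb : hardySlope n δ b t ≤ n / 2 + δ / 2 := by
    have : Real.log t ≤ Real.log r₂ := Real.log_le_log ht0 ht.2
    unfold hardySlope
    gcongr
    rw [hb]; linarith
  have hqa : n / 2 - δ / 2 ≤ hardySlope n δ a t := by
    have : Real.log r₁ ≤ Real.log t := Real.log_le_log h₁ ht.1
    have h2 : δ / (2 * (a - Real.log t)) = -(δ / (2 * (Real.log t - a))) := by
      rw [← neg_sub, mul_neg, div_neg]
    have h3 : δ / (2 * (Real.log t - a)) ≤ δ / 2 := by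
      gcongr
      rw [ha]; linarith
    unfold hardySlope
    linarith
  have hN : 0 ≤ t ^ n * ‖f t‖ ^ 2 := by positivity
  rw [hT T le_rfl] at hright
  have := mul_le_mul_of_nonneg_right hqa hN
  have := mul_le_mul_of_nonneg_right hqb hN
  rw [hsplit]
  simp only [norm_zero, ne_eq, OfNat.ofNat_ne_zero, not_false_eq_true, zero_pow, mul_zero,
    sub_zero] at hright
  linarith

/-! ### Integrals depending smoothly on a parameter -/

section ParametricIntegral

variable {V : Type} [NormedAddCommGroup V] [NormedSpace ℝ V]

lemma hasFDerivAt_comp_prodMk_left {F : Type} [NormedAddCommGroup F] [NormedSpace ℝ F]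
    {g : V × ℝ → F} (hg : ContDiff ℝ 1 g) (x : V) (u : ℝ) :
    HasFDerivAt (fun y => g (y, u)) ((fderiv ℝ g (x, u)).comp (.inl ℝ V ℝ)) x :=
  ((hg.differentiable one_ne_zero).differentiableAt.hasFDerivAt).comp x
    (hasFDerivAt_prodMk_left x u)

variable [FiniteDimensional ℝ V]

lemma hasFDerivAt_intervalIntegral_of_contDiff {F : Type} [NormedAddCommGroup F] [NormedSpace ℝ F]
    [CompleteSpace F] {g : V × ℝ → F} (hg : ContDiff ℝ 1 g) (a b : ℝ) (x : V) :
    HasFDerivAt (fun y => ∫ u in a..b, g (y, u))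
      (∫ u in a..b, (fderiv ℝ g (x, u)).comp (.inl ℝ V ℝ)) x := by
  have := FiniteDimensional.proper_real V
  have hD : Continuous fun p : V × ℝ => (fderiv ℝ g p).comp (.inl ℝ V ℝ) :=
    (hg.continuous_fderiv one_ne_zero).clm_comp continuous_const
  have hK := (isCompact_closedBall x 1).prod (isCompact_uIcc (a := a) (b := b))
  obtain ⟨C, hC⟩ := hK.exists_bound_of_continuousOn hD.continuousOn
  refine intervalIntegral.hasFDerivAt_integral_of_dominated_of_fderiv_le
    (F := fun y u => g (y, u)) (F' := fun y u => (fderiv ℝ g (y, u)).comp (.inl ℝ V ℝ))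
    (bound := fun _ => C) (Metric.closedBall_mem_nhds x one_pos) ?_ ?_ ?_ ?_ ?_ ?_
  · exact .of_forall fun y =>
      (hg.continuous.comp (Continuous.prodMk_right y)).aestronglyMeasurable
  · exact (hg.continuous.comp (Continuous.prodMk_right x)).intervalIntegrable _ _
  · exact (hD.comp (Continuous.prodMk_right x)).aestronglyMeasurable
  · exact .of_forall fun u hu y hy => hC (y, u) ⟨hy, Set.uIoc_subset_uIcc hu⟩
  · exact intervalIntegrable_const
  · exact .of_forall fun u _ y _ => hasFDerivAt_comp_prodMk_left hg y u

lemma contDiff_intervalIntegral_nat (a b : ℝ) (n : ℕ) :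
    ∀ {F : Type} [NormedAddCommGroup F] [NormedSpace ℝ F] [CompleteSpace F] {g : V × ℝ → F},
      ContDiff ℝ ∞ g → ContDiff ℝ n (fun y => ∫ u in a..b, g (y, u)) := by
  induction n with
  | zero =>
    intro F _ _ _ g hg
    rw [Nat.cast_zero, contDiff_zero]
    exact intervalIntegral.continuous_parametric_intervalIntegral_of_continuous'
      (f := fun y u => g (y, u)) hg.continuous a b
  | succ n ih =>
    intro F _ _ _ g hg
    have hd := hasFDerivAt_intervalIntegral_of_contDiff (hg.of_le (by norm_cast)) a b
    rw [Nat.cast_succ, contDiff_succ_iff_fderiv]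
    refine ⟨fun x => (hd x).differentiableAt, by simp, ?_⟩
    rw [funext fun x => (hd x).fderiv]
    exact ih ((hg.fderiv_right (m := ∞) le_rfl).clm_comp contDiff_const)

lemma contDiff_intervalIntegral {F : Type} [NormedAddCommGroup F] [NormedSpace ℝ F]
    [CompleteSpace F] {g : V × ℝ → F} (hg : ContDiff ℝ ∞ g) (a b : ℝ) :
    ContDiff ℝ ∞ (fun y => ∫ u in a..b, g (y, u)) :=
  contDiff_infty.2 fun n => contDiff_intervalIntegral_nat a b n hg

end ParametricIntegral

/-! ### The Poincaré gauge -/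

variable {d : ℕ}

/-- Alternating `1`-linear forms are continuous linear functionals. -/
def oneFormEquiv (d : ℕ) : (E d →L[ℝ] ℝ) ≃ₗᵢ[ℝ] ((E d) [⋀^Fin 1]→L[ℝ] ℝ) :=
  ContinuousAlternatingMap.ofSubsingletonLIE 0

/-- A `1`-form as a covector field. -/
def covectorField (A : Form d 1) (x : E d) : E d →L[ℝ] ℝ :=
  (oneFormEquiv d).symm (A x)

lemma covectorField_apply (A : Form d 1) (x v : E d) : covectorField A x v = A x ![v] := by
  have : oneFormEquiv d (covectorField A x) = A x := LinearIsometryEquiv.apply_symm_apply _ _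
  rw [← this]
  rfl

lemma contDiff_covectorField {A : Form d 1} (hA : ContDiff ℝ ∞ A) :
    ContDiff ℝ ∞ (covectorField A) :=
  (oneFormEquiv d).symm.toContinuousLinearEquiv.contDiff.comp hA

lemma extDeriv_one_form_apply {A : Form d 1} (hA : ContDiff ℝ ∞ A) (x v w : E d) :
    extDeriv A x ![v, w] =
      fderiv ℝ (covectorField A) x v w - fderiv ℝ (covectorField A) x w v := by
  have h : ∀ w : E d, fderiv ℝ (fun y => A y ![w]) x =
      (ContinuousLinearMap.apply ℝ ℝ w).comp (fderiv ℝ (covectorField A) x) := by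
    intro w
    have h1 : HasFDerivAt (covectorField A) (fderiv ℝ (covectorField A) x) x :=
      ((contDiff_covectorField hA).differentiable (by simp)).differentiableAt.hasFDerivAt
    have h2 := (ContinuousLinearMap.apply ℝ ℝ w).hasFDerivAt.comp x h1
    simp only [← covectorField_apply]
    exact h2.fderiv
  rw [extDeriv_apply (hA.differentiable (by simp)).differentiableAt]
  have e0 : (0 : Fin 2).removeNth ![v, w] = ![w] := by
    ext i j; fin_cases i; rfl
  have e1 : (1 : Fin 2).removeNth ![v, w] = ![v] := by
    ext i j; fin_cases i; rfl
  simp [Fin.sum_univ_two, e0, e1, h]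
  ring

/-- The function `χ(x) = ∫₀¹ A(ux)(x) du`, for which `A - dχ` is in the Poincaré gauge. -/
def gaugeFun (A : Form d 1) (x : E d) : ℝ := ∫ u in (0 : ℝ)..1, covectorField A (u • x) x

lemma contDiff_gauge_integrand {A : Form d 1} (hA : ContDiff ℝ ∞ A) :
    ContDiff ℝ ∞ (fun p : E d × ℝ => covectorField A (p.2 • p.1) p.1) :=
  ((contDiff_covectorField hA).comp (contDiff_snd.smul contDiff_fst)).clm_apply contDiff_fst

lemma contDiff_gaugeFun {A : Form d 1} (hA : ContDiff ℝ ∞ A) : ContDiff ℝ ∞ (gaugeFun A) :=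
  contDiff_intervalIntegral (contDiff_gauge_integrand hA) 0 1

lemma fderiv_gaugeFun_apply {A : Form d 1} (hA : ContDiff ℝ ∞ A) (x v : E d) :
    fderiv ℝ (gaugeFun A) x v = ∫ u in (0 : ℝ)..1,
      (u * fderiv ℝ (covectorField A) (u • x) v x + covectorField A (u • x) v) := by
  have hg1 : ContDiff ℝ 1 fun p : E d × ℝ => covectorField A (p.2 • p.1) p.1 :=
    (contDiff_gauge_integrand hA).of_le (by norm_cast)
  have hd := hasFDerivAt_intervalIntegral_of_contDiff hg1 0 1 x
  rw [show fderiv ℝ (gaugeFun A) x = _ from hd.fderiv, ContinuousLinearMap.intervalIntegral_apply]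
  · refine intervalIntegral.integral_congr fun u _ => ?_
    have h1 := hasFDerivAt_comp_prodMk_left hg1 x u
    have h2 : HasFDerivAt (covectorField A) (fderiv ℝ (covectorField A) (u • x)) (u • x) :=
      ((contDiff_covectorField hA).differentiable (by simp)).differentiableAt.hasFDerivAt
    have h3 := (h2.comp x ((hasFDerivAt_id x).const_smul u)).clm_apply (hasFDerivAt_id x)
    have h4 := h1.unique h3
    rw [h4]
    simp
    ring
  · exact (((hg1.continuous_fderiv one_ne_zero).clm_comp continuous_const).comp
      (Continuous.prodMk_right x)).intervalIntegrable _ _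

/-- Integrating `d/du (u A(ux)(v))` over `[0, 1]` shows that `A - dχ` is the potential of `dA` in
the Poincaré gauge. -/
lemma poincarePotential_apply {A : Form d 1} (hA : ContDiff ℝ ∞ A) {B : Form d 2}
    (hAB : ∀ x, extDeriv A x = B x) (x : E d) (j : Fin d) :
    poincarePotential B x j = A x ![stdVec j] - fderiv ℝ (gaugeFun A) x (stdVec j) := by
  set v : E d := stdVec j
  have hc : Continuous (covectorField A) := (contDiff_covectorField hA).continuous
  have hD : Continuous (fderiv ℝ (covectorField A)) :=
    (contDiff_covectorField hA).continuous_fderiv (by simp)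
  have hsm : Continuous fun u : ℝ => u • x := by fun_prop
  have i1 : ∀ w z : E d, IntervalIntegrable
      (fun u : ℝ => u * fderiv ℝ (covectorField A) (u • x) w z) volume 0 1 := fun w z =>
    (continuous_id.mul (((hD.comp hsm).clm_apply continuous_const).clm_apply
      continuous_const)).intervalIntegrable _ _
  have i2 : IntervalIntegrable (fun u : ℝ => covectorField A (u • x) v) volume 0 1 :=
    ((hc.comp hsm).clm_apply continuous_const).intervalIntegrable _ _
  have hftc : ∫ u in (0 : ℝ)..1, (u * fderiv ℝ (covectorField A) (u • x) x v +
      covectorField A (u • x) v) = covectorField A x v := by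
    have h : ∀ u ∈ Set.uIcc (0 : ℝ) 1, HasDerivAt (fun u : ℝ => u * covectorField A (u • x) v)
        (u * fderiv ℝ (covectorField A) (u • x) x v + covectorField A (u • x) v) u := by
      intro u _
      have h2 : HasFDerivAt (covectorField A) (fderiv ℝ (covectorField A) (u • x)) (u • x) :=
        ((contDiff_covectorField hA).differentiable (by simp)).differentiableAt.hasFDerivAt
      have h3 : HasDerivAt (fun u : ℝ => covectorField A (u • x) v)
          (fderiv ℝ (covectorField A) (u • x) x v) u := by
        have h4 : HasDerivAt (fun u : ℝ => u • x) x u := by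
          simpa using (hasDerivAt_id u).smul_const x
        have h5 := HasFDerivAt.comp_hasDerivAt (f := fun u : ℝ => u • x) u h2 h4
        exact (ContinuousLinearMap.apply ℝ ℝ v).hasFDerivAt.comp_hasDerivAt u h5
      refine ((hasDerivAt_id u).mul h3).congr_deriv ?_
      simp only [id_eq, one_mul]
      ring
    rw [intervalIntegral.integral_eq_sub_of_hasDerivAt h ((i1 x v).add i2)]
    simp
  rw [← covectorField_apply, fderiv_gaugeFun_apply hA, ← hftc, ← intervalIntegral.integral_sub
    ((i1 x v).add i2) ((i1 v x).add i2)]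
  refine intervalIntegral.integral_congr fun u _ => ?_
  simp only
  rw [← hAB, extDeriv_one_form_apply hA]
  ring

lemma continuous_poincarePotential {B : Form d 2} (hB : Continuous B) :
    Continuous (poincarePotential B) := by
  refine (PiLp.continuous_toLp 2 _).comp (continuous_pi fun j => ?_)
  refine intervalIntegral.continuous_parametric_intervalIntegral_of_continuous'
    (f := fun x u => B (u • x) ![x, stdVec j] * u) ?_ 0 1
  have h1 : Continuous fun p : E d × ℝ => B (p.2 • p.1) := hB.comp (by fun_prop)
  have h2 : Continuous fun p : E d × ℝ => (![p.1, stdVec j] : Fin 2 → E d) := by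
    refine continuous_pi fun i => ?_
    fin_cases i
    · exact continuous_fst
    · exact continuous_const
  exact (h1.eval h2).mul continuous_snd

lemma sum_smul_stdVec (x : E d) : ∑ j, x j • stdVec j = x := by
  ext i
  simp [stdVec, Finset.sum_apply, Pi.single_apply]

/-- In the Poincaré gauge the potential is purely angular. -/
lemma sum_mul_poincarePotential {B : Form d 2} (hB : Continuous B) (x : E d) :
    ∑ j, x j * poincarePotential B x j = 0 := by
  have hi : ∀ j : Fin d, IntervalIntegrable
      (fun u : ℝ => x j * (B (u • x) ![x, stdVec j] * u)) volume 0 1 := fun j => by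
    have h1 : Continuous fun u : ℝ => B (u • x) := hB.comp (by fun_prop)
    exact (continuous_const.mul ((h1.eval continuous_const).mul
      continuous_id)).intervalIntegrable _ _
  simp only [poincarePotential, ← intervalIntegral.integral_const_mul]
  rw [← intervalIntegral.integral_finsetSum fun j _ => hi j]
  refine (intervalIntegral.integral_congr (g := fun _ => (0 : ℝ)) fun u _ => ?_).trans (by simp)
  have hupd : ∀ y : E d, ![x, y] = Function.update ![x, 0] (1 : Fin 2) y := by
    intro y
    ext i j
    fin_cases i <;> rfl
  have : ∑ j, x j * B (u • x) ![x, stdVec j] = B (u • x) ![x, x] := by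
    have h := (B (u • x)).toMultilinearMap.map_update_sum Finset.univ 1
      (fun j => x j • stdVec j) ![x, 0]
    simp only [sum_smul_stdVec, ← hupd] at h
    refine Eq.trans (Finset.sum_congr rfl fun j _ => ?_) h.symm
    have h' := (B (u • x)).toMultilinearMap.map_update_smul ![x, 0] 1 (x j) (stdVec j)
    simp only [← hupd] at h'
    exact h'.symm
  have h0 : B (u • x) ![x, x] = 0 :=
    (B (u • x)).map_eq_zero_of_eq _ (i := 0) (j := 1) rfl (by decide)
  simp only [← mul_assoc]
  rw [← Finset.sum_mul, this, h0, zero_mul]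

/-- The gradient `∇ψ`, with components `∂_j ψ`. -/
def flatGrad (ψ : E d → ℂ) (x : E d) : EuclideanSpace ℂ (Fin d) :=
  WithLp.toLp 2 fun j => fderiv ℝ ψ x (stdVec j)

/-- The gauge transform `e^{-iχ} ψ`. -/
def gaugeTransform (χ : E d → ℝ) (ψ : E d → ℂ) (x : E d) : ℂ :=
  Complex.exp (-(Complex.I * (χ x : ℂ))) * ψ x

lemma norm_gaugeTransform (χ : E d → ℝ) (ψ : E d → ℂ) (x : E d) :
    ‖gaugeTransform χ ψ x‖ = ‖ψ x‖ := by
  simp [gaugeTransform, Complex.norm_exp]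

lemma contDiff_gaugeTransform {χ : E d → ℝ} {ψ : E d → ℂ} (hχ : ContDiff ℝ ∞ χ)
    (hψ : ContDiff ℝ ∞ ψ) : ContDiff ℝ ∞ (gaugeTransform χ ψ) := by
  unfold gaugeTransform
  exact ((contDiff_const.mul (Complex.ofRealCLM.contDiff.comp hχ)).neg.cexp).mul hψ

lemma fderiv_gaugeTransform_apply {χ : E d → ℝ} {ψ : E d → ℂ} (hχ : ContDiff ℝ ∞ χ)
    (hψ : ContDiff ℝ ∞ ψ) (x v : E d) :
    fderiv ℝ (gaugeTransform χ ψ) x v = Complex.exp (-(Complex.I * (χ x : ℂ))) *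
      (fderiv ℝ ψ x v - Complex.I * (fderiv ℝ χ x v : ℂ) * ψ x) := by
  have h1 : HasFDerivAt χ (fderiv ℝ χ x) x :=
    (hχ.differentiable (by simp)).differentiableAt.hasFDerivAt
  have h2 : HasFDerivAt ψ (fderiv ℝ ψ x) x :=
    (hψ.differentiable (by simp)).differentiableAt.hasFDerivAt
  have h3 := (((Complex.ofRealCLM.hasFDerivAt.comp x h1).const_mul Complex.I).neg.cexp).mul h2
  rw [show fderiv ℝ (gaugeTransform χ ψ) x = _ from h3.fderiv]
  simp
  ring

/-- Gauge covariance of the magnetic gradient. -/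
lemma norm_magGrad_eq {A : Form d 1} (hA : ContDiff ℝ ∞ A) {B : Form d 2}
    (hAB : ∀ x, extDeriv A x = B x) {ψ : E d → ℂ} (hψ : ContDiff ℝ ∞ ψ) (x : E d) :
    ‖magGrad A ψ x‖ = ‖magCovec (poincarePotential B x) (gaugeTransform (gaugeFun A) ψ x)
      (flatGrad (gaugeTransform (gaugeFun A) ψ) x)‖ := by
  have : magCovec (poincarePotential B x) (gaugeTransform (gaugeFun A) ψ x)
      (flatGrad (gaugeTransform (gaugeFun A) ψ) x) =
      Complex.exp (-(Complex.I * (gaugeFun A x : ℂ))) • magGrad A ψ x := by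
    ext j
    simp only [magCovec, flatGrad, magGrad, PiLp.smul_apply, smul_eq_mul,
      fderiv_gaugeTransform_apply (contDiff_gaugeFun hA) hψ, poincarePotential_apply hA hAB,
      gaugeTransform, Complex.ofReal_sub]
    ring
  rw [this, norm_smul]
  simp [Complex.norm_exp]

/-! ### Polar coordinates -/

instance : IsFiniteMeasure (surf d) :=
  inferInstanceAs (IsFiniteMeasure (volume : Measure (E d)).toSphere)

/-- The measure `dσ dr` on `S^{d-1} × (0, ∞)`, without the Jacobian of polar coordinates. -/
abbrev polarMeasure (d : ℕ) : Measure (Sph d × ℝ) :=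
  (surf d).prod (volume.restrict (Set.Ioi 0))

lemma ae_polar_pos : ∀ᵐ z ∂polarMeasure d, 0 < z.2 :=
  Measure.quasiMeasurePreserving_snd.ae (ae_restrict_mem measurableSet_Ioi)

lemma map_prod_volumeIoiPow (n : ℕ) :
    ((surf d).prod (Measure.volumeIoiPow n)).map (Prod.map id Subtype.val) =
      (polarMeasure d).withDensity fun z => ENNReal.ofReal (z.2 ^ n) := by
  have hemb : MeasurableEmbedding (Subtype.val : Set.Ioi (0 : ℝ) → ℝ) :=
    MeasurableEmbedding.subtype_coe measurableSet_Ioi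
  have hm : (Measure.volumeIoiPow n).map Subtype.val =
      (volume.restrict (Set.Ioi (0 : ℝ))).withDensity fun r => ENNReal.ofReal (r ^ n) := by
    ext s hs
    rw [hemb.map_apply, Measure.volumeIoiPow, withDensity_apply _ (hemb.measurable hs),
      withDensity_apply _ hs, ← map_comap_subtype_coe measurableSet_Ioi,
      hemb.restrict_map, hemb.lintegral_map]
  have hmeas : Measurable fun r : ℝ => ENNReal.ofReal (r ^ n) := by fun_prop
  have : SFinite ((Measure.volumeIoiPow n).map (Subtype.val : Set.Ioi (0 : ℝ) → ℝ)) := by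
    infer_instance
  rw [← Measure.map_prod_map _ _ measurable_id hemb.measurable, hm, Measure.map_id,
    prod_withDensity_right hmeas]

lemma map_smul_prod_volumeIoiPow (hd : 1 ≤ d) :
    MeasurableEmbedding (fun z : Sph d × Set.Ioi (0 : ℝ) => (z.2 : ℝ) • (z.1 : E d)) ∧
    ((surf d).prod (Measure.volumeIoiPow (d - 1))).map
      (fun z : Sph d × Set.Ioi (0 : ℝ) => (z.2 : ℝ) • (z.1 : E d)) = volume := by
  have : Nonempty (Fin d) := ⟨⟨0, hd⟩⟩
  have h1 : MeasurableEmbedding (Subtype.val : ({0}ᶜ : Set (E d)) → E d) :=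
    MeasurableEmbedding.subtype_coe (measurableSet_singleton _).compl
  have h2 := (homeomorphUnitSphereProd (E d)).symm.measurableEmbedding
  have h3 : (fun z : Sph d × Set.Ioi (0 : ℝ) => (z.2 : ℝ) • (z.1 : E d)) =
      Subtype.val ∘ (homeomorphUnitSphereProd (E d)).symm := by
    ext z
    simp
  have h4 := (volume : Measure (E d)).measurePreserving_homeomorphUnitSphereProd
  rw [finrank_euclideanSpace_fin] at h4
  refine ⟨h3 ▸ h1.comp h2, ?_⟩
  rw [h3, ← Measure.map_map h1.measurable h2.measurable]
  have h5 := (h4.symm (homeomorphUnitSphereProd (E d)).toMeasurableEquiv).map_eq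
  have h6 : ((surf d).prod (Measure.volumeIoiPow (d - 1))).map (homeomorphUnitSphereProd (E d)).symm
      = (volume : Measure (E d)).comap Subtype.val := h5
  rw [h6, map_comap_subtype_coe (measurableSet_singleton _).compl, restrict_compl_singleton]

/-- The function `r^{d-1} F(rσ)` on `S^{d-1} × (0, ∞)`. -/
def polarPullback (F : E d → ℝ) (z : Sph d × ℝ) : ℝ := z.2 ^ (d - 1) * F (z.2 • (z.1 : E d))

lemma toReal_ofReal_smul_ae_eq_polarPullback (F : E d → ℝ) :
    (fun z : Sph d × ℝ => (ENNReal.ofReal (z.2 ^ (d - 1))).toReal • F (z.2 • (z.1 : E d)))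
      =ᵐ[polarMeasure d] polarPullback F := by
  filter_upwards [ae_polar_pos] with z hz
  rw [ENNReal.toReal_ofReal (by positivity), polarPullback, smul_eq_mul]

lemma integrable_polarPullback_iff (hd : 1 ≤ d) {F : E d → ℝ} :
    Integrable (polarPullback F) (polarMeasure d) ↔ Integrable F := by
  obtain ⟨hemb, hmap⟩ := map_smul_prod_volumeIoiPow hd
  have hemb2 : MeasurableEmbedding (Prod.map id Subtype.val : Sph d × Set.Ioi (0 : ℝ) → _) :=
    MeasurableEmbedding.id.prodMap (MeasurableEmbedding.subtype_coe measurableSet_Ioi)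
  rw [← hmap, hemb.integrable_map_iff,
    ← integrable_congr (toReal_ofReal_smul_ae_eq_polarPullback F),
    ← integrable_withDensity_iff_integrable_smul' (by fun_prop) (by simp),
    ← map_prod_volumeIoiPow, hemb2.integrable_map_iff]
  rfl

lemma integral_polarPullback (hd : 1 ≤ d) (F : E d → ℝ) :
    ∫ z, polarPullback F z ∂polarMeasure d = ∫ x, F x := by
  obtain ⟨hemb, hmap⟩ := map_smul_prod_volumeIoiPow hd
  have hemb2 : MeasurableEmbedding (Prod.map id Subtype.val : Sph d × Set.Ioi (0 : ℝ) → _) :=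
    MeasurableEmbedding.id.prodMap (MeasurableEmbedding.subtype_coe measurableSet_Ioi)
  conv_rhs => rw [← hmap]
  rw [hemb.integral_map, ← integral_congr_ae (toReal_ofReal_smul_ae_eq_polarPullback F),
    ← integral_withDensity_eq_integral_toReal_smul (by fun_prop) (by simp),
    ← map_prod_volumeIoiPow, hemb2.integral_map]
  rfl

/-! ### Splitting the magnetic gradient into radial and tangential parts -/

lemma sum_sq_sphere (σ : Sph d) : ∑ j, (σ : E d) j ^ 2 = 1 := by
  have h : ‖(σ : E d)‖ = 1 := norm_eq_of_mem_sphere σ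
  have := EuclideanSpace.real_norm_sq_eq (σ : E d)
  rw [h] at this
  linarith

/-- Pythagoras' theorem for the orthogonal projection along a real unit vector. -/
lemma sum_norm_sq_eq_add_sum_norm_sq_sub (σ : Sph d) (w : Fin d → ℂ) :
    ∑ j, ‖w j‖ ^ 2 = ‖∑ j, (σ : E d) j • w j‖ ^ 2 +
      ∑ j, ‖w j - (σ : E d) j • ∑ k, (σ : E d) k • w k‖ ^ 2 := by
  set s := ∑ k, (σ : E d) k • w k with hs
  have h1 : ∑ j, (σ : E d) j * inner ℝ (w j) s = ‖s‖ ^ 2 := by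
    rw [← real_inner_self_eq_norm_sq]
    conv_rhs => enter [2]; rw [hs]
    rw [sum_inner]
    exact Finset.sum_congr rfl fun j _ => by rw [real_inner_smul_left]
  have h2 : ∀ j, ‖w j - (σ : E d) j • s‖ ^ 2 =
      ‖w j‖ ^ 2 - 2 * ((σ : E d) j * inner ℝ (w j) s) + (σ : E d) j ^ 2 * ‖s‖ ^ 2 := fun j => by
    rw [norm_sub_sq_real, inner_smul_right, norm_smul, mul_pow, Real.norm_eq_abs, sq_abs]
  simp only [h2, Finset.sum_add_distrib, Finset.sum_sub_distrib, ← Finset.mul_sum,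
    ← Finset.sum_mul, h1, sum_sq_sphere]
  ring

lemma hasDerivAt_ray {ψ : E d → ℂ} (hψ : ContDiff ℝ ∞ ψ) (σ : Sph d) (r : ℝ) :
    HasDerivAt (fun s : ℝ => ψ (s • (σ : E d))) (fderiv ℝ ψ (r • (σ : E d)) σ) r := by
  have h2 : HasFDerivAt ψ (fderiv ℝ ψ (r • (σ : E d))) (r • (σ : E d)) :=
    (hψ.differentiable (by simp)).differentiableAt.hasFDerivAt
  have h4 : HasDerivAt (fun u : ℝ => u • (σ : E d)) (σ : E d) r := by
    simpa using (hasDerivAt_id r).smul_const (σ : E d)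
  exact HasFDerivAt.comp_hasDerivAt (f := fun u : ℝ => u • (σ : E d)) r h2 h4

lemma sphGrad_dilation {ψ : E d → ℂ} (hψ : ContDiff ℝ ∞ ψ) (r : ℝ) (σ : Sph d) (j : Fin d) :
    sphGrad (fun x => ψ (r • x)) σ j = r • (fderiv ℝ ψ (r • (σ : E d)) (stdVec j) -
      (σ : E d) j • fderiv ℝ ψ (r • (σ : E d)) σ) := by
  have h2 : HasFDerivAt ψ (fderiv ℝ ψ (r • (σ : E d))) (r • (σ : E d)) :=
    (hψ.differentiable (by simp)).differentiableAt.hasFDerivAt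
  have h3 : HasFDerivAt (fun x : E d => ψ (r • x)) _ (σ : E d) :=
    HasFDerivAt.comp (f := fun x : E d => r • x) (σ : E d) h2
      ((hasFDerivAt_id (σ : E d)).const_smul r)
  simp [sphGrad, h3.fderiv]

/-- The square of the spherical magnetic gradient `(d' - i𝖠(σ,r)) ψ(r·)` at `σ`. -/
def tangentialSq (B : Form d 2) (ψ : E d → ℂ) (r : ℝ) (σ : Sph d) : ℝ :=
  ‖magCovec (sphPotential B r σ) (ψ (r • (σ : E d))) (sphGrad (fun x => ψ (r • x)) σ)‖ ^ 2

/-- In the Poincaré gauge the magnetic gradient is the orthogonal sum of the radial derivative and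
of the spherical magnetic gradient divided by the radius. -/
lemma norm_sq_magCovec_polar {B : Form d 2} (hB : Continuous B) {ψ : E d → ℂ}
    (hψ : ContDiff ℝ ∞ ψ) {r : ℝ} (hr : 0 < r) (σ : Sph d) :
    ‖magCovec (poincarePotential B (r • (σ : E d))) (ψ (r • (σ : E d)))
      (flatGrad ψ (r • (σ : E d)))‖ ^ 2 =
    ‖fderiv ℝ ψ (r • (σ : E d)) σ‖ ^ 2 + (r ^ 2)⁻¹ * tangentialSq B ψ r σ := by
  set x := r • (σ : E d) with hx
  set a := poincarePotential B x with ha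
  set w : Fin d → ℂ := fun j => fderiv ℝ ψ x (stdVec j) - Complex.I * ((a j : ℝ) : ℂ) * ψ x with hw
  have hs : ∑ j, (σ : E d) j • w j = fderiv ℝ ψ x σ := by
    have h0 : ∑ j, (σ : E d) j * a j = 0 := by
      have h := sum_mul_poincarePotential hB x
      simp only [hx, PiLp.smul_apply, smul_eq_mul, mul_assoc, ← Finset.mul_sum] at h
      exact (mul_eq_zero.1 h).resolve_left hr.ne'
    have h1 : ∑ j, (σ : E d) j • fderiv ℝ ψ x (stdVec j) = fderiv ℝ ψ x σ := by
      conv_rhs => rw [← sum_smul_stdVec (σ : E d), map_sum]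
      simp
    have h2 : ∑ j, (σ : E d) j • (Complex.I * ((a j : ℝ) : ℂ) * ψ x) = 0 := by
      have : ∀ j, (σ : E d) j • (Complex.I * ((a j : ℝ) : ℂ) * ψ x) =
          (((σ : E d) j * a j : ℝ) : ℂ) * (Complex.I * ψ x) := fun j => by
        rw [Complex.real_smul]; push_cast; ring
      simp only [this]
      rw [← Finset.sum_mul, ← Complex.ofReal_sum, h0]
      simp
    simp only [hw, smul_sub, Finset.sum_sub_distrib, h1, h2, sub_zero]
  have hl : ‖magCovec a (ψ x) (flatGrad ψ x)‖ ^ 2 = ∑ j, ‖w j‖ ^ 2 := by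
    rw [EuclideanSpace.norm_sq_eq]
    rfl
  have ht : tangentialSq B ψ r σ = r ^ 2 * ∑ j, ‖w j - (σ : E d) j • fderiv ℝ ψ x σ‖ ^ 2 := by
    rw [tangentialSq, EuclideanSpace.norm_sq_eq, Finset.mul_sum]
    refine Finset.sum_congr rfl fun j _ => ?_
    have : magCovec (sphPotential B r σ) (ψ (r • (σ : E d))) (sphGrad (fun x => ψ (r • x)) σ) j =
        r • (w j - (σ : E d) j • fderiv ℝ ψ x σ) := by
      simp only [magCovec, sphGrad_dilation hψ, sphPotential, hw, PiLp.smul_apply,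
        Complex.real_smul, smul_eq_mul, Complex.ofReal_mul]
      ring
    rw [this, norm_smul, mul_pow, Real.norm_eq_abs, sq_abs]
  rw [hl, ht, sum_norm_sq_eq_add_sum_norm_sq_sub σ w, hs]
  field_simp

/-! ### The spectral gap on spheres -/

lemma continuous_sphGrad {Φ : E d → ℂ} (hΦ : ContDiff ℝ ∞ Φ) : Continuous (sphGrad Φ) := by
  refine (PiLp.continuous_toLp 2 _).comp (continuous_pi fun j => ?_)
  have h1 : Continuous fun σ : Sph d => fderiv ℝ Φ (σ : E d) :=
    (hΦ.continuous_fderiv (by simp)).comp continuous_subtype_val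
  exact h1.clm_apply (by fun_prop)

lemma integrable_surf_of_continuous {f : Sph d → ℝ} (hf : Continuous f) :
    Integrable f (surf d) :=
  hf.integrable_of_hasCompactSupport (HasCompactSupport.of_compactSpace f)

lemma isH1_of_contDiff {Φ : E d → ℂ} (hΦ : ContDiff ℝ ∞ Φ) :
    IsH1 (fun σ : Sph d => Φ σ) (sphGrad Φ) := by
  refine ⟨(hΦ.continuous.comp continuous_subtype_val).memLp_of_hasCompactSupport
    (HasCompactSupport.of_compactSpace _), (continuous_sphGrad hΦ).memLp_of_hasCompactSupport
    (HasCompactSupport.of_compactSpace _), fun _ => Φ, fun _ => hΦ, ?_, ?_⟩ <;>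
  simp

lemma nu_nonneg (B : Form d 2) (r : ℝ) : 0 ≤ nu B r := by
  refine Real.sInf_nonneg ?_
  rintro q ⟨φ, G, -, -, rfl⟩
  positivity

/-- The variational characterization of `nu`, tested on smooth functions. -/
lemma nu_mul_integral_le (B : Form d 2) (r : ℝ) {Φ : E d → ℂ} (hΦ : ContDiff ℝ ∞ Φ) :
    nu B r * ∫ σ : Sph d, ‖Φ σ‖ ^ 2 ∂surf d ≤
      ∫ σ : Sph d, ‖magCovec (sphPotential B r σ) (Φ σ) (sphGrad Φ σ)‖ ^ 2 ∂surf d := by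
  have hc : Continuous fun σ : Sph d => ‖Φ σ‖ ^ 2 :=
    (hΦ.continuous.comp continuous_subtype_val).norm.pow 2
  have hN : 0 ≤ ∫ σ : Sph d, ‖Φ σ‖ ^ 2 ∂surf d := integral_nonneg fun σ => by positivity
  rcases hN.eq_or_lt with h0 | hpos
  · rw [← h0, mul_zero]
    exact integral_nonneg fun σ => by positivity
  · rw [← le_div_iff₀ hpos]
    refine csInf_le ⟨0, ?_⟩ ⟨fun σ => Φ σ, sphGrad Φ, isH1_of_contDiff hΦ, fun h => ?_, rfl⟩
    · rintro q ⟨φ, G, -, -, rfl⟩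
      positivity
    · refine hpos.ne' ?_
      rw [integral_congr_ae (g := fun _ => (0 : ℝ)) (h.mono fun σ hσ => by simp_all)]
      simp

lemma continuous_magCovec {X : Type*} [TopologicalSpace X] {a : X → E d} {φ : X → ℂ}
    {G : X → EuclideanSpace ℂ (Fin d)} (ha : Continuous a) (hφ : Continuous φ)
    (hG : Continuous G) : Continuous fun x => magCovec (a x) (φ x) (G x) := by
  refine (PiLp.continuous_toLp 2 _).comp (continuous_pi fun j => ?_)
  have h1 : Continuous fun x => ((a x j : ℝ) : ℂ) := by fun_prop
  have h2 : Continuous fun x => G x j := by fun_prop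
  fun_prop

lemma norm_sq_magCovec_le (a b : E d) (φ : ℂ) (G : EuclideanSpace ℂ (Fin d)) :
    ‖magCovec a φ G‖ ^ 2 ≤ 2 * ‖magCovec b φ G‖ ^ 2 + 2 * ‖a - b‖ ^ 2 * ‖φ‖ ^ 2 := by
  rw [EuclideanSpace.norm_sq_eq, EuclideanSpace.norm_sq_eq, EuclideanSpace.norm_sq_eq,
    Finset.mul_sum, Finset.mul_sum, Finset.sum_mul, ← Finset.sum_add_distrib]
  refine Finset.sum_le_sum fun j _ => ?_
  have h : magCovec a φ G j = magCovec b φ G j - Complex.I * (((a - b) j : ℝ) : ℂ) * φ := by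
    simp only [magCovec, PiLp.sub_apply, Complex.ofReal_sub]
    ring
  have h1 : ‖Complex.I * (((a - b) j : ℝ) : ℂ) * φ‖ = ‖(a - b) j‖ * ‖φ‖ := by
    rw [norm_mul, norm_mul, Complex.norm_I, one_mul, Complex.norm_real]
  have h2 := norm_sub_le (magCovec b φ G j) (Complex.I * (((a - b) j : ℝ) : ℂ) * φ)
  rw [← h, h1] at h2
  calc ‖magCovec a φ G j‖ ^ 2 ≤ (‖magCovec b φ G j‖ + ‖(a - b) j‖ * ‖φ‖) ^ 2 := by gcongr
    _ ≤ _ := by nlinarith [sq_nonneg (‖magCovec b φ G j‖ - ‖(a - b) j‖ * ‖φ‖)]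

lemma continuous_sphPotential {B : Form d 2} (hB : Continuous B) :
    Continuous fun p : ℝ × Sph d => sphPotential B p.1 p.2 := by
  unfold sphPotential
  exact continuous_fst.smul ((continuous_poincarePotential hB).comp (by fun_prop))

lemma continuous_tangentialSq {B : Form d 2} (hB : Continuous B) {ψ : E d → ℂ}
    (hψ : ContDiff ℝ ∞ ψ) (r : ℝ) : Continuous (tangentialSq B ψ r) := by
  have h : ContDiff ℝ ∞ fun x : E d => ψ (r • x) := hψ.comp (contDiff_const_smul r)
  exact (continuous_magCovec ((continuous_sphPotential hB).comp (Continuous.prodMk_right r))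
    (h.continuous.comp continuous_subtype_val) (continuous_sphGrad h)).norm.pow 2

/-- By continuity of the potential, a spectral gap on one sphere gives a uniform spectral gap on the
spheres of nearby radii. -/
lemma exists_uniform_gap {B : Form d 2} (hB : Continuous B) {r₀ : ℝ} (hr₀ : 0 < r₀)
    (hnu : nu B r₀ ≠ 0) :
    ∃ κ r₁ r₂ : ℝ, 0 < κ ∧ κ ≤ 1 ∧ 0 < r₁ ∧ r₁ < r₂ ∧ ∀ ψ : E d → ℂ, ContDiff ℝ ∞ ψ →
      ∀ r ∈ Set.Icc r₁ r₂, κ * ∫ σ : Sph d, ‖ψ (r • (σ : E d))‖ ^ 2 ∂surf d ≤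
        ∫ σ, tangentialSq B ψ r σ ∂surf d := by
  set ν := nu B r₀ with hν
  have hνpos : 0 < ν := lt_of_le_of_ne (nu_nonneg B r₀) (Ne.symm hnu)
  have hev : ∀ᶠ r in 𝓝 r₀, ∀ σ ∈ (Set.univ : Set (Sph d)),
      ‖sphPotential B r₀ σ - sphPotential B r σ‖ ^ 2 < ν / 4 := by
    refine isCompact_univ.eventually_forall_of_forall_eventually fun σ _ => ?_
    have hc : Continuous fun p : ℝ × Sph d =>
        ‖sphPotential B r₀ p.2 - sphPotential B p.1 p.2‖ ^ 2 :=
      (((continuous_sphPotential hB).comp (Continuous.prodMk_right r₀ |>.comp continuous_snd)).sub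
        (continuous_sphPotential hB)).norm.pow 2
    refine hc.tendsto (r₀, σ) |>.eventually_lt_const ?_
    simp [hνpos]
  obtain ⟨ε, hε, hball⟩ := Metric.eventually_nhds_iff.1 hev
  refine ⟨min 1 (ν / 4), r₀, r₀ + ε / 2, lt_min one_pos (by linarith), min_le_left _ _, hr₀,
    by linarith, fun ψ hψ r hr => ?_⟩
  have hclose := fun σ : Sph d => (hball (y := r) (by
    rw [Real.dist_eq, abs_of_nonneg (by linarith [hr.1])]; linarith [hr.2]) σ trivial).le
  have hΦ : ContDiff ℝ ∞ fun x : E d => ψ (r • x) := hψ.comp (contDiff_const_smul r)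
  have hφc : Continuous fun σ : Sph d => ‖ψ (r • (σ : E d))‖ ^ 2 :=
    (hΦ.continuous.comp continuous_subtype_val).norm.pow 2
  have hN : 0 ≤ ∫ σ : Sph d, ‖ψ (r • (σ : E d))‖ ^ 2 ∂surf d :=
    integral_nonneg fun σ => by positivity
  have h1 := nu_mul_integral_le B r₀ hΦ
  have h2 : ∫ σ : Sph d, ‖magCovec (sphPotential B r₀ σ) (ψ (r • (σ : E d)))
      (sphGrad (fun x => ψ (r • x)) σ)‖ ^ 2 ∂surf d ≤
      ∫ σ : Sph d, (2 * tangentialSq B ψ r σ + ν / 2 * ‖ψ (r • (σ : E d))‖ ^ 2) ∂surf d := by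
    refine integral_mono (integrable_surf_of_continuous ?_) (integrable_surf_of_continuous ?_)
      fun σ => ?_
    · exact (continuous_magCovec ((continuous_sphPotential hB).comp (Continuous.prodMk_right r₀))
        (hΦ.continuous.comp continuous_subtype_val) (continuous_sphGrad hΦ)).norm.pow 2
    · exact ((continuous_tangentialSq hB hψ r).const_mul 2).add (hφc.const_mul _)
    · refine (norm_sq_magCovec_le _ (sphPotential B r σ) _ _).trans ?_
      have := mul_le_mul_of_nonneg_right (hclose σ) (sq_nonneg ‖ψ (r • (σ : E d))‖)
      simp only [tangentialSq]
      linarith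
  rw [integral_add ((integrable_surf_of_continuous (continuous_tangentialSq hB hψ r)).const_mul 2)
    ((integrable_surf_of_continuous hφc).const_mul _), integral_const_mul,
    integral_const_mul] at h2
  have h3 := mul_le_mul_of_nonneg_right (min_le_right 1 (ν / 4)) hN
  simp only [← hν] at h1
  linarith

/-! ### The inequality in the Poincaré gauge -/

lemma norm_ray (σ : Sph d) (r : ℝ) : ‖r • (σ : E d)‖ = |r| := by
  rw [norm_smul, norm_eq_of_mem_sphere, mul_one, Real.norm_eq_abs]

lemma integrable_polar_of_continuous {f : Sph d × ℝ → ℝ} (hf : Continuous f) {R : ℝ}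
    (h0 : ∀ z, R < |z.2| → f z = 0) : Integrable f (polarMeasure d) := by
  refine hf.integrable_of_hasCompactSupport (HasCompactSupport.of_support_subset_isCompact
    (isCompact_univ.prod (isCompact_closedBall (0 : ℝ) R)) fun z hz => ⟨trivial, ?_⟩)
  by_contra h
  refine hz (h0 z ?_)
  simpa using h

lemma continuous_sq_mul_log_sq : Continuous fun t : ℝ => 1 + t ^ 2 * Real.log t ^ 2 := by
  have : (fun t : ℝ => 1 + t ^ 2 * Real.log t ^ 2) = fun t => 1 + (t * Real.log t) ^ 2 := by
    ext t; ring
  rw [this]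
  exact continuous_const.add (Real.continuous_mul_log.pow 2)

/-- The Hardy potential term is integrable; for `d = 2` this holds because its coefficient
vanishes. -/
lemma integrable_hardy_term (hd : 2 ≤ d) {ψ : E d → ℂ} (hψ : Continuous ψ) {R : ℝ}
    (hR : ∀ x, R < ‖x‖ → ψ x = 0) :
    Integrable fun x => hardyConst d * (‖ψ x‖ ^ 2 / ‖x‖ ^ 2) := by
  rcases hd.eq_or_lt with rfl | hd3
  · simp [hardyConst]
  · rw [← integrable_polarPullback_iff (by omega)]
    have hc : Integrable (fun z : Sph d × ℝ =>
        z.2 ^ (d - 3) * (hardyConst d * ‖ψ (z.2 • (z.1 : E d))‖ ^ 2)) (polarMeasure d) := by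
      refine integrable_polar_of_continuous (R := R) (by fun_prop) fun z hz => ?_
      rw [hR _ (by rwa [norm_ray])]
      simp
    refine hc.congr ?_
    filter_upwards [ae_polar_pos] with z hz
    obtain ⟨k, rfl⟩ : ∃ k, d = k + 3 := ⟨d - 3, by omega⟩
    simp only [polarPullback, norm_ray, sq_abs, Nat.add_sub_cancel,
      show k + 3 - 1 = k + 2 from rfl]
    field_simp
    ring

/-- The magnetic Hardy inequality for potentials in the Poincaré gauge. The radial derivative gives
the Hardy term and the logarithmic weight up to point evaluations on the spheres of radius
`t ∈ [r₁, r₂]`, and these are absorbed by the spherical magnetic gradient. -/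
theorem exists_hardy_poincare_gauge (hd : 2 ≤ d) {B : Form d 2} (hB : Continuous B)
    (hnu : ∃ r : ℝ, 0 < r ∧ nu B r ≠ 0) :
    ∃ c : ℝ, 0 < c ∧ ∀ ψ : E d → ℂ, ContDiff ℝ ∞ ψ → HasCompactSupport ψ →
      c * ∫ x, ‖ψ x‖ ^ 2 / (1 + ‖x‖ ^ 2 * Real.log ‖x‖ ^ 2) ≤
        (∫ x, ‖magCovec (poincarePotential B x) (ψ x) (flatGrad ψ x)‖ ^ 2) -
          hardyConst d * ∫ x, ‖ψ x‖ ^ 2 / ‖x‖ ^ 2 := by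
  obtain ⟨r₀, hr₀, hnu⟩ := hnu
  obtain ⟨κ, r₁, r₂, hκ, hκ1, hr₁, hr₁₂, hgap⟩ := exists_uniform_gap hB hr₀ hnu
  have hr₂ : 0 < r₂ := hr₁.trans hr₁₂
  -- with this `δ`, integrating the spherical bound over `[r₁, r₂]` exactly balances the point term
  set δ := κ * ((r₂ - r₁) / r₂) with hδ
  have hδ0 : 0 < δ := mul_pos hκ (div_pos (by linarith) hr₂)
  have hδ1 : δ ≤ 1 := by
    have : (r₂ - r₁) / r₂ ≤ 1 := (div_le_one hr₂).2 (by linarith)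
    exact mul_le_one₀ hκ1 (div_nonneg (by linarith) hr₂.le) this
  obtain ⟨γ, hγ, hrad⟩ := exists_radial_hardy (r₂ := r₂) hδ0 hδ1 hr₁
  refine ⟨γ, hγ, fun ψ hψ hsupp => ?_⟩
  obtain ⟨R, hR⟩ : ∃ R, ∀ x, R < ‖x‖ → ψ x = 0 ∧ fderiv ℝ ψ x = 0 := by
    obtain ⟨R, hR⟩ := hsupp.isCompact.isBounded.subset_closedBall 0
    refine ⟨R, fun x hx => ?_⟩
    have hx' : x ∉ tsupport ψ := fun h => by
      have := hR h
      rw [Metric.mem_closedBall, dist_zero_right] at this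
      linarith
    exact ⟨image_eq_zero_of_notMem_tsupport hx',
      image_eq_zero_of_notMem_tsupport fun h => hx' (tsupport_fderiv_subset ℝ h)⟩
  have hψc : Continuous ψ := hψ.continuous
  have hψ'c : Continuous (fderiv ℝ ψ) := hψ.continuous_fderiv (by simp)
  -- energy density, Hardy term and weight on `ℝ^d`; radial and tangential energy densities and the
  -- radial density with all subtractions on `S^{d-1} × (0, ∞)`
  set M : E d → ℝ := fun x => ‖magCovec (poincarePotential B x) (ψ x) (flatGrad ψ x)‖ ^ 2 with hM
  set Q : E d → ℝ := fun x => hardyConst d * (‖ψ x‖ ^ 2 / ‖x‖ ^ 2) with hQ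
  set W : E d → ℝ := fun x => ‖ψ x‖ ^ 2 / (1 + ‖x‖ ^ 2 * Real.log ‖x‖ ^ 2) with hW
  set D : Sph d × ℝ → ℝ := fun z =>
    z.2 ^ (d - 1) * ‖fderiv ℝ ψ (z.2 • (z.1 : E d)) z.1‖ ^ 2 with hD
  set T : Sph d × ℝ → ℝ := fun z =>
    z.2 ^ (d - 1) * ((z.2 ^ 2)⁻¹ * tangentialSq B ψ z.2 z.1) with hT
  set g : Sph d × ℝ → ℝ := fun z =>
    radialDensity (d - 2) γ (fun s => ψ (s • (z.1 : E d))) z.2 with hg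
  have iM : Integrable M := by
    have hc : Continuous M := (continuous_magCovec (continuous_poincarePotential hB) hψc
      ((PiLp.continuous_toLp 2 _).comp (continuous_pi fun j =>
        hψ'c.clm_apply continuous_const))).norm.pow 2
    refine hc.integrable_of_hasCompactSupport (HasCompactSupport.of_support_subset_isCompact
      (isCompact_closedBall (0 : E d) R) fun x hx => ?_)
    by_contra h
    obtain ⟨h1, h2⟩ := hR x (by simpa using h)
    refine hx ?_
    simp only [hM, EuclideanSpace.norm_sq_eq]
    simp [magCovec, flatGrad, h1, h2]
  have iW : Integrable W := by
    have hc : Continuous W := (hψc.norm.pow 2).div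
      (continuous_sq_mul_log_sq.comp continuous_norm) fun x => by positivity
    refine hc.integrable_of_hasCompactSupport (HasCompactSupport.of_support_subset_isCompact
      (isCompact_closedBall (0 : E d) R) fun x hx => ?_)
    by_contra h
    refine hx ?_
    simp [hW, (hR x (by simpa using h)).1]
  have iQ : Integrable Q := integrable_hardy_term hd hψc fun x hx => (hR x hx).1
  have iD : Integrable D (polarMeasure d) := by
    have h1 : Continuous fun z : Sph d × ℝ => fderiv ℝ ψ (z.2 • (z.1 : E d)) z.1 :=
      (hψ'c.comp (by fun_prop)).clm_apply (by fun_prop)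
    refine integrable_polar_of_continuous (R := R)
      ((continuous_snd.pow (d - 1)).mul (h1.norm.pow 2)) fun z hz => ?_
    simp [hD, (hR (z.2 • (z.1 : E d)) (by rwa [norm_ray])).2]
  have hd1 : 1 ≤ d := by omega
  have iM' := (integrable_polarPullback_iff hd1).2 iM
  have iQ' := (integrable_polarPullback_iff hd1).2 iQ
  have iW' := (integrable_polarPullback_iff hd1).2 iW
  have hTae : (fun z => polarPullback M z - D z) =ᵐ[polarMeasure d] T := by
    filter_upwards [ae_polar_pos] with z hz
    simp only [polarPullback, hM, hD, hT, norm_sq_magCovec_polar hB hψ hz]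
    ring
  have hgae : (fun z => D z - polarPullback Q z - γ * polarPullback W z)
      =ᵐ[polarMeasure d] g := by
    filter_upwards [ae_polar_pos] with z hz
    obtain ⟨k, rfl⟩ : ∃ k, d = k + 2 := ⟨d - 2, by omega⟩
    simp only [polarPullback, hQ, hW, hD, hg, radialDensity, (hasDerivAt_ray hψ z.1 z.2).deriv,
      norm_ray, abs_of_pos hz, hardyConst, Nat.add_sub_cancel, show k + 2 - 1 = k + 1 from rfl]
    push_cast
    ring
  have iT : Integrable T (polarMeasure d) := (iM'.sub iD).congr hTae
  have iDQ : Integrable (fun z => D z - polarPullback Q z) (polarMeasure d) := iD.sub iQ'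
  have ig : Integrable g (polarMeasure d) := (iDQ.sub (iW'.const_mul γ)).congr hgae
  have eT : ∫ z, T z ∂polarMeasure d = (∫ x, M x) - ∫ z, D z ∂polarMeasure d := by
    rw [← integral_congr_ae hTae, integral_sub iM' iD, integral_polarPullback hd1]
  have eg : ∫ z, g z ∂polarMeasure d =
      (∫ z, D z ∂polarMeasure d) - (∫ x, Q x) - γ * ∫ x, W x := by
    rw [← integral_congr_ae hgae, integral_sub iDQ (iW'.const_mul γ),
      integral_sub iD iQ', integral_const_mul, integral_polarPullback hd1,
      integral_polarPullback hd1]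
  set I := ∫ z, g z ∂polarMeasure d with hI
  have hpoint : ∀ t ∈ Set.Icc r₁ r₂,
      0 ≤ I + δ * (t ^ (d - 2) * ∫ σ : Sph d, ‖ψ (t • (σ : E d))‖ ^ 2 ∂surf d) := by
    intro t ht
    have hNc : Continuous fun σ : Sph d => ‖ψ (t • (σ : E d))‖ ^ 2 :=
      (hψc.comp ((continuous_const_smul t).comp continuous_subtype_val)).norm.pow 2
    have hNi := integrable_surf_of_continuous hNc
    have e : I + δ * (t ^ (d - 2) * ∫ σ : Sph d, ‖ψ (t • (σ : E d))‖ ^ 2 ∂surf d) =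
        ∫ σ : Sph d, ((∫ r in Set.Ioi 0, g (σ, r)) +
          δ * (t ^ (d - 2) * ‖ψ (t • (σ : E d))‖ ^ 2)) ∂surf d := by
      rw [integral_add ig.integral_prod_left ((hNi.const_mul _).const_mul _),
        integral_const_mul, integral_const_mul, hI, integral_prod _ ig]
    rw [e]
    refine integral_nonneg_of_ae ?_
    filter_upwards [ig.prod_right_ae] with σ hσ
    refine hrad (d - 2) (fun s => ψ (s • (σ : E d))) ?_ ?_ hσ t ht
    · exact (hψ.comp (contDiff_id.smul contDiff_const)).of_le (by norm_cast)
    · refine HasCompactSupport.of_support_subset_isCompact (isCompact_closedBall (0 : ℝ) R)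
        fun s hs => ?_
      by_contra h
      exact hs (hR _ (by rw [norm_ray]; simpa using h)).1
  have hTnn : ∀ r : ℝ, 0 < r → 0 ≤ ∫ σ : Sph d, T (σ, r) ∂surf d := fun r hr =>
    integral_nonneg fun σ => by simp only [hT, tangentialSq]; positivity
  have hsum : 0 ≤ (∫ z, T z ∂polarMeasure d) + I := by
    have eTs : ∫ z, T z ∂polarMeasure d =
        ∫ r in Set.Ioi 0, ∫ σ : Sph d, T (σ, r) ∂surf d := integral_prod_symm _ iT
    rcases le_or_gt 0 I with hI0 | hI0
    · rw [eTs]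
      exact add_nonneg (setIntegral_nonneg measurableSet_Ioi fun r hr => hTnn r hr) hI0
    have hlow : ∀ r ∈ Set.Icc r₁ r₂, κ / (δ * r₂) * (-I) ≤ ∫ σ : Sph d, T (σ, r) ∂surf d := by
      intro r hr
      have hr0 : 0 < r := hr₁.trans_le hr.1
      set N := ∫ σ : Sph d, ‖ψ (r • (σ : E d))‖ ^ 2 ∂surf d with hN
      have h1 : (-I) / δ ≤ r ^ (d - 2) * N := by
        rw [div_le_iff₀' hδ0]
        linarith [hpoint r hr]
      have hpow : r ^ (d - 1) * (r ^ 2)⁻¹ = r ^ (d - 2) / r := by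
        obtain ⟨k, rfl⟩ : ∃ k, d = k + 2 := ⟨d - 2, by omega⟩
        simp only [Nat.add_sub_cancel, show k + 2 - 1 = k + 1 from rfl]
        field_simp
        ring
      calc κ / (δ * r₂) * (-I) = κ / r₂ * ((-I) / δ) := by field_simp
        _ ≤ κ / r * (r ^ (d - 2) * N) := by
            have : 0 ≤ (-I) / δ := div_nonneg (by linarith) hδ0.le
            gcongr
            exact hr.2
        _ = r ^ (d - 1) * (r ^ 2)⁻¹ * (κ * N) := by rw [hpow]; ring
        _ ≤ r ^ (d - 1) * (r ^ 2)⁻¹ * ∫ σ, tangentialSq B ψ r σ ∂surf d := by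
            gcongr
            exact hgap ψ hψ r hr
        _ = ∫ σ : Sph d, T (σ, r) ∂surf d := by
            simp only [hT]
            rw [integral_const_mul, integral_const_mul, mul_assoc]
    have hsub : Set.Icc r₁ r₂ ⊆ Set.Ioi 0 := fun r hr => hr₁.trans_le hr.1
    have iTr : IntegrableOn (fun r => ∫ σ : Sph d, T (σ, r) ∂surf d) (Set.Ioi 0) :=
      iT.integral_prod_right
    have h1 : ∫ _ in Set.Icc r₁ r₂, κ / (δ * r₂) * (-I) ≤ ∫ z, T z ∂polarMeasure d := by
      rw [eTs]
      refine (setIntegral_mono_on continuous_const.integrableOn_Icc (iTr.mono_set hsub)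
        measurableSet_Icc hlow).trans ?_
      exact setIntegral_mono_set iTr
        ((ae_restrict_mem measurableSet_Ioi).mono fun r hr => hTnn r hr) hsub.eventuallyLE
    have h2 : ∫ _ in Set.Icc r₁ r₂, κ / (δ * r₂) * (-I) = -I := by
      rw [setIntegral_const, smul_eq_mul, Real.volume_real_Icc_of_le hr₁₂.le, hδ]
      have : r₂ - r₁ ≠ 0 := by linarith
      field_simp
    linarith
  have hQe : ∫ x, Q x = hardyConst d * ∫ x, ‖ψ x‖ ^ 2 / ‖x‖ ^ 2 := integral_const_mul _ _
  rw [← hQe]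
  linarith

end MagneticHardy

end

theorem mainTheorem7 (d : ℕ) (hd : 2 ≤ d) (B : MagneticHardy.Form d 2)
    (hB : ContDiff ℝ ∞ B) (hclosed : ∀ x, extDeriv B x = 0)
    (hnu : ∃ r : ℝ, 0 < r ∧ MagneticHardy.nu B r ≠ 0) :
    ∃ c : ℝ, 0 < c ∧
      ∀ A : MagneticHardy.Form d 1, ContDiff ℝ ∞ A → (∀ x, extDeriv A x = B x) →
        ∀ ψ : MagneticHardy.E d → ℂ, ContDiff ℝ ∞ ψ → HasCompactSupport ψ →
          c * ∫ x, ‖ψ x‖ ^ 2 / (1 + ‖x‖ ^ 2 * Real.log ‖x‖ ^ 2) ≤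
            MagneticHardy.magForm A ψ := by
  obtain ⟨c, hc, h⟩ := MagneticHardy.exists_hardy_poincare_gauge hd hB.continuous hnu
  refine ⟨c, hc, fun A hA hAB ψ hψ hsupp => ?_⟩
  have hgauge := h (MagneticHardy.gaugeTransform (MagneticHardy.gaugeFun A) ψ)
    (MagneticHardy.contDiff_gaugeTransform (MagneticHardy.contDiff_gaugeFun hA) hψ)
    hsupp.mul_left
  simp only [MagneticHardy.norm_gaugeTransform,
    ← MagneticHardy.norm_magGrad_eq hA hAB hψ] at hgauge
  exact hgauge
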